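/- Let $m\ge n\ge 2$ and let $\Omega\subset\mathbb{R}^{m+n}=\mathbb{R}^m\times\mathbb{R}^n$ be a domain. Call a function $v:D\to[-\infty,+\infty)$ on an open set $D\subset\mathbb{R}^N$ subharmonic if it is upper semicontinuous and $$v(x)\le \frac{1}{\nu_N r^N}\int_{B^N(x,r)}v(y)\,dm_N(y)\qquad\text{for all closed balls }\overline{B^N(x,r)}\subset D,\ r>0,$$ where $m_N$ is Lebesgue measure, $B^N(x,r)$ is the open Euclidean ball with centre $x$ and radius $r$, and $\nu_N=m_N(B^N(0,1))$ (the function $v\equiv-\infty$ is allowed). Let $u:\Omega\to[-\infty,+\infty)$ satisfy the following conditions. (a) For each $y\in\mathbb{R}^n$ the function $x\mapsto u(x,y)$ is subharmonic on $\Omega(y)=\{x\in\mathbb{R}^m:(x,y)\in\Omega\}$. (b) For each $x\in\mathbb{R}^m$ the function $y\mapsto u(x,y)$ is subharmonic on $\Omega(x)=\{y\in\mathbb{R}^n:(x,y)\in\Omega\}$. (c) There is a strictly increasing surjection $\varphi:[0,+\infty)\to[0,+\infty)$ such that $$\int_1^{+\infty}\frac{s^{(n-1)/(m-1)}}{\varphi(s)^{1/(m-1)}}\,ds<+\infty$$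 and $\varphi\big(\log^+[(u^+)^r]\big)\in\mathcal{L}^1_{\mathrm{loc}}(\Omega)$ for some $r>0$, where $u^+=\max\{u,0\}$ and $\log^+ t=\max\{\log t,0\}$, with $\log^+0=0$. Then $u$ is subharmonic in $\Omega$. -/

import Mathlib

open MeasureTheory Set

noncomputable section

/-- The mean value over the open ball `B(x, r)` of an extended-real-valued function, namely the mean
of the positive part minus the mean of the negative part. It is only used for functions that are
upper semicontinuous and less than `⊤` on the closed ball, for which the first mean is finite, so
that the value is a well-defined element of `[-∞, ∞)`. -/
def ballMean {N : ℕ} (u : EuclideanSpace ℝ (Fin N) → EReal)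
    (x : EuclideanSpace ℝ (Fin N)) (r : ℝ) : EReal :=
  ((⨍⁻ y in Metric.ball x r, (u y).toENNReal ∂volume : ENNReal) : EReal) -
    ((⨍⁻ y in Metric.ball x r, (-u y).toENNReal ∂volume : ENNReal) : EReal)

/-- `u : D → [-∞, ∞)` is subharmonic on the (open, possibly disconnected or empty) set `D`:
it is upper semicontinuous and satisfies the sub-mean value inequality on every closed ball
contained in `D`. The function identically `-∞` is allowed. -/
structure IsSubharmonicOn {N : ℕ} (u : EuclideanSpace ℝ (Fin N) → EReal)
    (D : Set (EuclideanSpace ℝ (Fin N))) : Prop where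
  lt_top : ∀ x ∈ D, u x < ⊤
  upperSemicontinuousOn : UpperSemicontinuousOn u D
  le_ballMean : ∀ (x : EuclideanSpace ℝ (Fin N)) (r : ℝ), 0 < r →
    Metric.closedBall x r ⊆ D → u x ≤ ballMean u x r

/-- The point `(x, y)` of `ℝ^{m+n}` for `x ∈ ℝ^m` and `y ∈ ℝ^n`. -/
def joinPt {m n : ℕ} (x : EuclideanSpace ℝ (Fin m)) (y : EuclideanSpace ℝ (Fin n)) :
    EuclideanSpace ℝ (Fin (m + n)) :=
  WithLp.toLp 2 (Fin.append (fun i => x i) (fun j => y j))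

/-- `u` is separately subharmonic on `Ω ⊆ ℝ^{m+n}`: for each `y` the function `x ↦ u(x, y)` is
subharmonic on the section `Ω(y) = {x | (x, y) ∈ Ω}`, and for each `x` the function `y ↦ u(x, y)` is
subharmonic on the section `Ω(x) = {y | (x, y) ∈ Ω}`. -/
structure IsSeparatelySubharmonicOn {m n : ℕ} (u : EuclideanSpace ℝ (Fin (m + n)) → EReal)
    (Ω : Set (EuclideanSpace ℝ (Fin (m + n)))) : Prop where
  left : ∀ y : EuclideanSpace ℝ (Fin n),
    IsSubharmonicOn (fun x : EuclideanSpace ℝ (Fin m) => u (joinPt x y)) {x | joinPt x y ∈ Ω}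
  right : ∀ x : EuclideanSpace ℝ (Fin m),
    IsSubharmonicOn (fun y : EuclideanSpace ℝ (Fin n) => u (joinPt x y)) {y | joinPt x y ∈ Ω}

end

/-!
The proof has two halves: `u` is locally bounded above, and a locally bounded separately subharmonic
function is subharmonic.

*Local boundedness.* Put `K = exp (1 / r)`, so that `φ (log⁺ ((u⁺) ^ r)) ≥ φ j` wherever
`u ≥ K ^ j`. The tool is a chain estimate in the style of Domar (`radius_le_of_chain`). Let `v ≥ 0`
have the sub-mean value property on a ball of radius `d` in dimension `N`, and let `ρ j` be the
distance from the centre at which the level `K ^ j` is first reached. The sub-mean value inequality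
on the ball with radius `ρ (j + 1) - ρ j` around a point where this happens shows that `v` is at
least `K ^ (j - 1)` on a fixed proportion of that ball, located in the annulus between the radii
`ρ j` and `ρ (j + 1)` (`volume_ball_le_volume_annulus`). The annuli are disjoint and the increments
of `ρ` add up to `d`, so Hölder's inequality bounds `d` by an integral of the weights attached to
the levels times the tail sum of their powers with exponent `-1 / (N - 1)`.

In the second variable, with the weights `φ j`, this bounds `I x = ∫ φ (log⁺ (u⁺ (x, y) ^ r)) dy`
from below by a multiple of `T i ^ (-(n - 1))` as soon as `u (x, ·)` reaches the level
`K ^ (i + 4)`, where `T i` is a tail sum of `φ ^ (-1 / (n - 1))`. Used as weights in the first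
variable, together with `∫ I < ∞`, these lower bounds exclude large values of `u`, provided that
`∑ T i ^ p < ∞` for `p = (n - 1) / (m - 1)`. As `p ≤ 1`, which is where `n ≤ m` enters, a Hardy
inequality for nonincreasing functions (`lintegral_rpow_lintegral_Ioi_le`) derives this from the
integral condition on `φ` (`IsSeparatelySubharmonicOn.exists_eventually_le`).

*Subharmonicity.* The means of `u (·, y)` over balls with a fixed radius are jointly upper
semicontinuous by Fatou's lemma, they majorize `u`, and they are close to `u` when the radius is
small; hence `u` is upper semicontinuous (`IsSeparatelySubharmonicOn.upperSemicontinuousAt`). The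
slices of a ball of `ℝ^{m+n}` parallel to the factors are balls, so Tonelli's theorem and the two
partial sub-mean value inequalities give the sub-mean value inequality on balls of `ℝ^{m+n}`
(`IsSeparatelySubharmonicOn.le_ballMean`).
-/

open scoped ENNReal

/-! ### Mean values of extended-real-valued functions -/

lemma UpperSemicontinuousOn.aemeasurable_restrict {α : Type*} [TopologicalSpace α]
    [MeasurableSpace α] [OpensMeasurableSpace α] {μ : Measure α} {u : α → EReal} {D s : Set α}
    (hu : UpperSemicontinuousOn u D) (hs : MeasurableSet s) (hsD : s ⊆ D) :
    AEMeasurable u (μ.restrict s) := by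
  have h : Measurable (s.domRestrict u) :=
    (upperSemicontinuousOn_iff_restrict.mpr (hu.mono hsD)).measurable
  exact (aemeasurable_restrict_iff_comap_subtype hs).2 h.aemeasurable

lemma EReal.ofReal_add_toENNReal_neg {M : ℝ} (hM : 0 ≤ M) {a : EReal} (ha : a ≤ M) :
    ENNReal.ofReal M + (-a).toENNReal = ((M : EReal) - a).toENNReal + a.toENNReal := by
  induction a using EReal.rec with
  | bot => simp
  | top => simp at ha
  | coe a =>
    rw [EReal.coe_le_coe_iff] at ha
    have h1 : (-(a : EReal)).toENNReal = ENNReal.ofReal (-a) := by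
      rw [← EReal.coe_neg]; rfl
    have h2 : ((M : EReal) - a).toENNReal = ENNReal.ofReal (M - a) := by
      rw [← EReal.coe_sub]; rfl
    rw [h1, h2, EReal.real_coe_toENNReal]
    rcases le_total 0 a with h | h
    · rw [ENNReal.ofReal_of_nonpos (by linarith : -a ≤ 0), ← ENNReal.ofReal_add (by linarith) h]
      simp
    · rw [ENNReal.ofReal_of_nonpos h, ← ENNReal.ofReal_add hM (by linarith)]
      simp [sub_eq_add_neg]

lemma EReal.le_sub_iff_le_toENNReal {M : ℝ} {c : EReal} (hc : c ≤ M) {a b D : ℝ≥0∞}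
    (ha : a ≠ ∞) (h : ENNReal.ofReal M + b = D + a) (hM : 0 ≤ M) :
    c ≤ (a : EReal) - (b : EReal) ↔ D ≤ ((M : EReal) - c).toENNReal := by
  induction c using EReal.rec with
  | bot => simp
  | top => simp at hc
  | coe c =>
    rw [EReal.coe_le_coe_iff] at hc
    have h2 : ((M : EReal) - c).toENNReal = ENNReal.ofReal (M - c) := by
      rw [← EReal.coe_sub]; rfl
    rw [h2]
    by_cases hb : b = ∞
    · subst hb
      have hD : D = ∞ := by
        by_contra hD
        simp only [add_top] at h
        exact ENNReal.add_ne_top.2 ⟨hD, ha⟩ h.symm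
      simp [hD]
    · have hD : D ≠ ∞ := by
        rintro rfl
        simp [hb] at h
      lift a to NNReal using ha
      lift b to NNReal using hb
      lift D to NNReal using hD
      have e : M + b = D + a := by
        have := congrArg ENNReal.toReal h
        rwa [ENNReal.toReal_add (by simp) (by simp), ENNReal.toReal_add (by simp) (by simp),
          ENNReal.toReal_ofReal hM] at this
      rw [← ENNReal.ofReal_coe_nnreal (p := D),
        ENNReal.ofReal_le_ofReal_iff (by linarith)]
      change (c : EReal) ≤ ((a : ℝ) : EReal) - ((b : ℝ) : EReal) ↔ _
      rw [← EReal.coe_sub, EReal.coe_le_coe_iff]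
      constructor <;> intro h <;> linarith

/-- For a function bounded above by the constant `M ≥ 0`, the sub-mean value inequality for `u` is
the super-mean value inequality for the nonnegative function `M - u`. -/
lemma le_ballMean_iff {N : ℕ} {u : EuclideanSpace ℝ (Fin N) → EReal} {x : EuclideanSpace ℝ (Fin N)}
    {r M : ℝ} (hr : 0 < r) (hM : 0 ≤ M) (hu : ∀ y ∈ Metric.ball x r, u y ≤ M)
    (hmeas : AEMeasurable u (volume.restrict (Metric.ball x r))) :
    u x ≤ ballMean u x r ↔
      ∫⁻ y in Metric.ball x r, ((M : EReal) - u y).toENNReal ≤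
        volume (Metric.ball x r) * ((M : EReal) - u x).toENNReal := by
  have hν0 : volume (Metric.ball x r) ≠ 0 := (Metric.measure_ball_pos volume x hr).ne'
  have hνt : volume (Metric.ball x r) ≠ ∞ := measure_ball_lt_top.ne
  have hpos : AEMeasurable (fun y => (u y).toENNReal) (volume.restrict (Metric.ball x r)) :=
    measurable_ereal_toENNReal.comp_aemeasurable hmeas
  have ha : ∫⁻ y in Metric.ball x r, (u y).toENNReal ≤
      ENNReal.ofReal M * volume (Metric.ball x r) := by
    calc _ ≤ ∫⁻ y in Metric.ball x r, ENNReal.ofReal M :=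
          setLIntegral_mono' measurableSet_ball fun y hy =>
            EReal.toENNReal_le_toENNReal (hu y hy)
      _ = _ := by simp
  have key : ENNReal.ofReal M * volume (Metric.ball x r) +
      ∫⁻ y in Metric.ball x r, (-u y).toENNReal =
      (∫⁻ y in Metric.ball x r, ((M : EReal) - u y).toENNReal) +
        ∫⁻ y in Metric.ball x r, (u y).toENNReal := by
    rw [← lintegral_add_right' _ hpos, ← setLIntegral_const, ← lintegral_add_left measurable_const]
    exact setLIntegral_congr_fun measurableSet_ball fun y hy =>
      EReal.ofReal_add_toENNReal_neg hM (hu y hy)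
  unfold ballMean
  rw [setLAverage_eq, setLAverage_eq]
  rw [EReal.le_sub_iff_le_toENNReal (hu x (Metric.mem_ball_self hr))
    (D := (∫⁻ y in Metric.ball x r, ((M : EReal) - u y).toENNReal) / volume (Metric.ball x r))
    _ _ hM]
  · rw [ENNReal.div_le_iff hν0 hνt, mul_comm]
  · exact ENNReal.div_ne_top (ne_top_of_le_ne_top (by finiteness) ha) hν0
  · rw [← ENNReal.add_div, ← key, ENNReal.add_div, ENNReal.mul_div_cancel_right hν0 hνt]

/-- The positive part of a subharmonic function satisfies the sub-mean value inequality. -/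
lemma volume_ball_mul_toENNReal_le {N : ℕ} {u : EuclideanSpace ℝ (Fin N) → EReal}
    {x : EuclideanSpace ℝ (Fin N)} {r : ℝ} (hr : 0 < r) (h : u x ≤ ballMean u x r) :
    volume (Metric.ball x r) * (u x).toENNReal ≤
      ∫⁻ y in Metric.ball x r, (u y).toENNReal := by
  have hν0 : volume (Metric.ball x r) ≠ 0 := (Metric.measure_ball_pos volume x hr).ne'
  have hνt : volume (Metric.ball x r) ≠ ∞ := measure_ball_lt_top.ne
  have h1 : (u x).toENNReal ≤ ⨍⁻ y in Metric.ball x r, (u y).toENNReal ∂volume := by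
    have h2 : u x ≤ ((⨍⁻ y in Metric.ball x r, (u y).toENNReal ∂volume : ℝ≥0∞) : EReal) := by
      refine h.trans ?_
      unfold ballMean
      refine (EReal.sub_le_sub le_rfl (EReal.coe_ennreal_nonneg _)).trans ?_
      simp
    simpa using EReal.toENNReal_le_toENNReal h2
  rw [setLAverage_eq, ENNReal.le_div_iff_mul_le (Or.inl hν0) (Or.inl hνt)] at h1
  rwa [mul_comm]

/-! ### The share of an annulus in a high level set -/

/-- A ball centred on the boundary of another ball has at most half of its volume inside it. -/
lemma two_mul_volume_ball_inter_ball_le {N : ℕ} (x₀ x₁ : EuclideanSpace ℝ (Fin N)) (R : ℝ) :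
    2 * volume (Metric.ball x₁ R ∩ Metric.ball x₀ (dist x₁ x₀)) ≤ volume (Metric.ball x₁ R) := by
  set A := Metric.ball x₁ R ∩ Metric.ball x₀ (dist x₁ x₀)
  have hA : MeasurableSet A := measurableSet_ball.inter measurableSet_ball
  -- the reflection in `x₁`
  have hT := Measure.measurePreserving_sub_left
    (volume : Measure (EuclideanSpace ℝ (Fin N))) (x₁ + x₁)
  have hvol : volume ((fun x => x₁ + x₁ - x) ⁻¹' A) = volume A :=
    hT.measure_preimage hA.nullMeasurableSet
  have hdisj : Disjoint A ((fun x => x₁ + x₁ - x) ⁻¹' A) := by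
    rw [Set.disjoint_left]
    rintro x ⟨-, hx⟩ ⟨-, hx'⟩
    rw [Metric.mem_ball] at hx hx'
    have h : dist (x₁ + x₁) (x₀ + x₀) ≤ dist x x₀ + dist (x₁ + x₁ - x) x₀ := by
      calc dist (x₁ + x₁) (x₀ + x₀) = dist (x + (x₁ + x₁ - x)) (x₀ + x₀) := by congr 1; abel
        _ ≤ _ := dist_add_add_le _ _ _ _
    have h2 : dist (x₁ + x₁) (x₀ + x₀) = 2 * dist x₁ x₀ := by
      rw [dist_eq_norm, dist_eq_norm, show x₁ + x₁ - (x₀ + x₀) = (2 : ℝ) • (x₁ - x₀) by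
        rw [two_smul]; abel, norm_smul]
      simp
    linarith
  calc 2 * volume A = volume A + volume ((fun x => x₁ + x₁ - x) ⁻¹' A) := by rw [hvol, two_mul]
    _ = volume (A ∪ ((fun x => x₁ + x₁ - x) ⁻¹' A)) :=
        (measure_union hdisj (hT.measurable hA)).symm
    _ ≤ volume (Metric.ball x₁ R) := by
        refine measure_mono (union_subset inter_subset_left ?_)
        rintro x ⟨hx, -⟩
        rw [Metric.mem_ball, dist_eq_norm] at hx
        rw [Metric.mem_ball, dist_comm, dist_eq_norm]
        convert hx using 2
        beta_reduce
        abel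

/-- If `v` reaches the level `K * L` at a point `x₁`, stays below it on the ball around `x₀` having
`x₁` on its boundary, and stays below `K ^ 2 * L` on the concentric ball with radius larger by `R`,
then the sub-mean value inequality on the ball `B(x₁, R)` forces `v` to exceed `L` on a substantial
part of the annulus between these two balls. -/
lemma volume_ball_le_volume_annulus {N : ℕ} {v : EuclideanSpace ℝ (Fin N) → ℝ≥0∞}
    {x₀ x₁ : EuclideanSpace ℝ (Fin N)} {R K L : ℝ} (hK : 1 < K) (hL : 0 < L)
    (hsub : volume (Metric.ball x₁ R) * ENNReal.ofReal (K * L) ≤ ∫⁻ y in Metric.ball x₁ R, v y)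
    (h1 : ∀ x ∈ Metric.ball x₀ (dist x₁ x₀), v x ≤ ENNReal.ofReal (K * L))
    (h2 : ∀ x ∈ Metric.ball x₀ (dist x₁ x₀ + R), v x ≤ ENNReal.ofReal (K * (K * L)))
    {S : Set (EuclideanSpace ℝ (Fin N))} (hS : MeasurableSet S)
    (hSv : ∀ x ∈ Metric.ball x₁ R, x ∉ S → v x ≤ ENNReal.ofReal L) :
    volume (Metric.ball x₁ R) ≤ ENNReal.ofReal (2 * K ^ 2 / (K - 1)) *
      volume (S ∩ (fun x => dist x x₀) ⁻¹' Ico (dist x₁ x₀) (dist x₁ x₀ + R)) := by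
  set ρ := dist x₁ x₀
  set B := Metric.ball x₁ R
  set B₀ := Metric.ball x₀ ρ
  have hB : MeasurableSet B := measurableSet_ball
  have hB₀ : MeasurableSet B₀ := measurableSet_ball
  set P := S ∩ (fun x => dist x x₀) ⁻¹' Ico ρ (ρ + R)
  have hBP : ∀ x ∈ B, x ∈ Metric.ball x₀ (ρ + R) := fun x hx => by
    rw [Metric.mem_ball] at hx ⊢
    linarith [dist_triangle x x₁ x₀]
  have hsplit : ∫⁻ y in B, v y = (∫⁻ y in B ∩ B₀, v y) + ∫⁻ y in B \ B₀, v y :=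
    (lintegral_inter_add_sdiff _ _ hB₀).symm
  have hin : ∫⁻ y in B ∩ B₀, v y ≤ ENNReal.ofReal (K * L) * volume (B ∩ B₀) := by
    rw [← setLIntegral_const]
    exact setLIntegral_mono' (hB.inter hB₀) fun y hy => h1 y hy.2
  have hout : ∫⁻ y in B \ B₀, v y ≤
      ENNReal.ofReal L * volume (B \ B₀) + ENNReal.ofReal (K * (K * L)) * volume (B ∩ P) := by
    calc ∫⁻ y in B \ B₀, v y
        ≤ ∫⁻ y in B \ B₀, (ENNReal.ofReal L +
            S.indicator (fun _ => ENNReal.ofReal (K * (K * L))) y) := by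
          refine setLIntegral_mono' (hB.diff hB₀) fun y hy => ?_
          by_cases hyS : y ∈ S
          · rw [indicator_of_mem hyS]
            exact (h2 y (hBP y hy.1)).trans le_add_self
          · rw [indicator_of_notMem hyS, add_zero]
            exact hSv y hy.1 hyS
      _ = ENNReal.ofReal L * volume (B \ B₀) +
            ENNReal.ofReal (K * (K * L)) * volume (S ∩ (B \ B₀)) := by
          rw [lintegral_add_left measurable_const, setLIntegral_const, lintegral_indicator hS,
            setLIntegral_const, Measure.restrict_apply hS]
      _ ≤ _ := by
          refine add_le_add le_rfl (mul_le_mul_right (measure_mono ?_) _)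
          rintro y ⟨hyS, hyB, hy0⟩
          refine ⟨hyB, hyS, ?_, ?_⟩
          · simpa [B₀] using hy0
          · exact hBP y hyB
  have hhalf : 2 * volume (B ∩ B₀) ≤ volume B := two_mul_volume_ball_inter_ball_le x₀ x₁ R
  have hBsum : volume B = volume (B ∩ B₀) + volume (B \ B₀) :=
    (measure_inter_add_sdiff B hB₀).symm
  have hmono : volume (B ∩ P) ≤ volume P := measure_mono inter_subset_right
  refine le_trans ?_ (mul_le_mul_right hmono _)
  have hall : volume B * ENNReal.ofReal (K * L) ≤ ENNReal.ofReal (K * L) * volume (B ∩ B₀) +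
      (ENNReal.ofReal L * volume (B \ B₀) + ENNReal.ofReal (K * (K * L)) * volume (B ∩ P)) :=
    hsub.trans (hsplit.le.trans (add_le_add hin hout))
  have f1 : volume B ≠ ∞ := measure_ball_lt_top.ne
  have f2 : volume (B ∩ B₀) ≠ ∞ := ne_top_of_le_ne_top f1 (measure_mono inter_subset_left)
  have f3 : volume (B \ B₀) ≠ ∞ := ne_top_of_le_ne_top f1 (measure_mono sdiff_subset)
  have f4 : volume (B ∩ P) ≠ ∞ := ne_top_of_le_ne_top f1 (measure_mono inter_subset_left)
  generalize volume B = b at *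
  generalize volume (B ∩ B₀) = b1 at *
  generalize volume (B \ B₀) = b2 at *
  generalize volume (B ∩ P) = σ at *
  lift b1 to NNReal using f2
  lift b2 to NNReal using f3
  lift σ to NNReal using f4
  lift b to NNReal using f1
  have hKpos : 0 < K := by linarith
  have e1 := congrArg ENNReal.toReal hBsum
  have e2 := ENNReal.toReal_mono (by finiteness) hhalf
  have e3 := ENNReal.toReal_mono (by finiteness) hall
  rw [ENNReal.toReal_add (by finiteness) (by finiteness)] at e1
  rw [ENNReal.toReal_add (by finiteness) (by finiteness),
    ENNReal.toReal_add (by finiteness) (by finiteness)] at e3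
  simp only [ENNReal.toReal_mul, ENNReal.coe_toReal, ENNReal.toReal_ofNat,
    ENNReal.toReal_ofReal hL.le, ENNReal.toReal_ofReal (mul_pos hKpos hL).le,
    ENNReal.toReal_ofReal (mul_pos hKpos (mul_pos hKpos hL)).le] at e1 e2 e3
  rw [← ENNReal.ofReal_coe_nnreal, ← ENNReal.ofReal_coe_nnreal,
    ← ENNReal.ofReal_mul (by have : 0 < K - 1 := by linarith
                             positivity)]
  apply ENNReal.ofReal_le_ofReal
  rw [div_mul_eq_mul_div, le_div_iff₀ (by linarith)]
  have e4 : K * (b : ℝ) ≤ K * b1 + (b2 + K * K * σ) := by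
    refine le_of_mul_le_mul_left ?_ hL
    linarith
  rw [e1] at e4 e2 ⊢
  have e5 : (K - 1) * (b2 : ℝ) ≤ K * K * σ := by linarith
  have e6 : (K - 1) * (b1 : ℝ) ≤ (K - 1) * b2 :=
    mul_le_mul_of_nonneg_left (by linarith) (by linarith)
  linarith

/-! ### The chain estimate -/

/-- The constant of the chain estimate in dimension `N` with level ratio `K`: the constant of
`volume_ball_le_volume_annulus` divided by the volume of the unit ball. -/
noncomputable def chainConst (N : ℕ) (K : ℝ) : ℝ≥0∞ :=
  ENNReal.ofReal (2 * K ^ 2 / (K - 1)) /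
    volume (Metric.ball (0 : EuclideanSpace ℝ (Fin N)) 1)

lemma chainConst_ne_zero (N : ℕ) {K : ℝ} (hK : 1 < K) : chainConst N K ≠ 0 := by
  have : 0 < 2 * K ^ 2 / (K - 1) := div_pos (by positivity) (by linarith)
  exact (ENNReal.div_pos (by simpa using this) measure_ball_lt_top.ne).ne'

lemma chainConst_ne_top (N : ℕ) (K : ℝ) : chainConst N K ≠ ∞ :=
  ENNReal.div_ne_top ENNReal.ofReal_ne_top (Metric.measure_ball_pos _ _ one_pos).ne'

/-- Hölder's inequality with weights: a sum is controlled by the `p`-th powers with weights `A`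
and the sum of the conjugate negative powers of the weights. -/
lemma sum_le_of_weights {N : ℕ} (hN : 2 ≤ N) (s : Finset ℕ) (R A : ℕ → ℝ≥0∞)
    (hA0 : ∀ j, A j ≠ 0) (hAt : ∀ j, A j ≠ ∞) :
    ∑ j ∈ s, R j ≤ (∑ j ∈ s, A j * R j ^ N) ^ (1 / (N : ℝ)) *
      (∑ j ∈ s, A j ^ (-1 / ((N : ℝ) - 1))) ^ (((N : ℝ) - 1) / N) := by
  have hN1 : (1 : ℝ) < N := by exact_mod_cast hN
  have hpq : (N : ℝ).HolderConjugate (N / (N - 1)) := Real.HolderConjugate.conjExponent hN1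
  have h := ENNReal.inner_le_Lp_mul_Lq s (fun j => A j ^ (1 / (N : ℝ)) * R j)
    (fun j => A j ^ (-(1 / (N : ℝ)))) hpq
  convert h using 1
  · refine Finset.sum_congr rfl fun j _ => ?_
    rw [mul_right_comm, ← ENNReal.rpow_add _ _ (hA0 j) (hAt j)]
    simp
  · congr 2
    · refine Finset.sum_congr rfl fun j _ => ?_
      rw [ENNReal.mul_rpow_of_nonneg _ _ (by positivity), ← ENNReal.rpow_mul,
        one_div_mul_cancel (by positivity), ENNReal.rpow_one, ENNReal.rpow_natCast]
    · refine Finset.sum_congr rfl fun j _ => ?_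
      rw [← ENNReal.rpow_mul]
      congr 1
      have : (N : ℝ) - 1 ≠ 0 := by linarith
      field_simp
    · rw [one_div_div]

/-- **Chain estimate.** Let `v` be a nonnegative finite upper semicontinuous function on a closed
ball, with the sub-mean value property. If `v` is large at the centre, then the radius of the ball
is controlled by the integral of any `W` which dominates the weight `A j` where `v` reaches the
level `K ^ (J + j)`.

The radius is the sum of the increments of the distances at which the successive levels are first
reached; the successive annuli are disjoint, each of them contains a substantial part of the
previous level set, and the increments are summed by Hölder's inequality. No measurability of `W` is
needed, since the lower integral `∫⁻` is monotone and additive over the measurable annuli. -/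
theorem radius_le_of_chain {N : ℕ} (hN : 2 ≤ N) {v : EuclideanSpace ℝ (Fin N) → ℝ≥0∞}
    {x₀ : EuclideanSpace ℝ (Fin N)} {d K : ℝ} (hd : 0 < d) (hK : 1 < K)
    (husc : UpperSemicontinuousOn v (Metric.closedBall x₀ d))
    (hfin : ∀ x ∈ Metric.closedBall x₀ d, v x < ∞)
    (hsub : ∀ x ρ, 0 < ρ → Metric.closedBall x ρ ⊆ Metric.closedBall x₀ d →
      volume (Metric.ball x ρ) * v x ≤ ∫⁻ y in Metric.ball x ρ, v y)
    {J : ℕ} (hJ : ENNReal.ofReal (K ^ (J + 1)) ≤ v x₀)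
    {W : EuclideanSpace ℝ (Fin N) → ℝ≥0∞} {A : ℕ → ℝ≥0∞}
    (hA0 : ∀ j, A j ≠ 0) (hAt : ∀ j, A j ≠ ∞)
    (hAW : ∀ᵐ x ∂volume, x ∈ Metric.closedBall x₀ d →
      ∀ j, ENNReal.ofReal (K ^ (J + j)) ≤ v x → A j ≤ W x) :
    ENNReal.ofReal d ≤
      (chainConst N K * ∫⁻ x in Metric.closedBall x₀ d, W x) ^ (1 / (N : ℝ)) *
        (∑' j, A j ^ (-1 / ((N : ℝ) - 1))) ^ (((N : ℝ) - 1) / N) := by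
  have hN1 : (1 : ℝ) < N := by exact_mod_cast hN
  have hKpos : 0 < K := by linarith
  have : Nontrivial (EuclideanSpace ℝ (Fin N)) := by
    have : Nonempty (Fin N) := ⟨⟨0, by omega⟩⟩
    infer_instance
  -- the level sets, and the distances at which they are first reached
  set Q := Metric.closedBall x₀ d
  have hQc : IsCompact Q := isCompact_closedBall x₀ d
  let S : ℕ → Set (EuclideanSpace ℝ (Fin N)) := fun j =>
    Q ∩ v ⁻¹' Ici (ENNReal.ofReal (K ^ (J + j)))
  have hSc : ∀ j, IsCompact (S j) := fun j => husc.isCompact_inter_preimage_Ici hQc _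
  have hSanti : ∀ j, S (j + 1) ⊆ S j := fun j x hx =>
    ⟨hx.1, (ENNReal.ofReal_le_ofReal (pow_le_pow_right₀ hK.le (by omega))).trans hx.2⟩
  let D : ℕ → Set ℝ := fun j => insert d ((fun x => dist x x₀) '' S (j + 1))
  have hDc : ∀ j, IsCompact (D j) := fun j =>
    ((hSc _).image (by fun_prop)).insert d
  let ρ : ℕ → ℝ := fun j => sInf (D j)
  have hρmem : ∀ j, ρ j ∈ D j := fun j => (hDc j).sInf_mem (insert_nonempty _ _)
  have hρle : ∀ j, ∀ t ∈ D j, ρ j ≤ t := fun j t ht => csInf_le (hDc j).bddBelow ht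
  have hρd : ∀ j, ρ j ≤ d := fun j => hρle j d (mem_insert _ _)
  have hρnn : ∀ j, 0 ≤ ρ j := fun j => by
    rcases hρmem j with h | ⟨x, -, h⟩
    · rw [h]; exact hd.le
    · rw [← h]; exact dist_nonneg
  have hρmono : Monotone ρ := monotone_nat_of_le_succ fun j => by
    refine hρle j _ ?_
    exact insert_subset_insert (image_mono (hSanti (j + 1))) (hρmem (j + 1))
  have hρ0 : ρ 0 = 0 := le_antisymm
    (hρle 0 0 (mem_insert_of_mem _ ⟨x₀, ⟨Metric.mem_closedBall_self hd.le, hJ⟩, dist_self _⟩))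
    (hρnn 0)
  -- `v` is bounded on the compact ball, so high levels are not reached at all
  obtain ⟨T, hT⟩ : ∃ T, ρ T = d := by
    obtain ⟨a, haQ, ha⟩ := husc.exists_isMaxOn ⟨x₀, Metric.mem_closedBall_self hd.le⟩ hQc
    obtain ⟨T, hT⟩ := pow_unbounded_of_one_lt (v a).toReal hK
    refine ⟨T, ?_⟩
    rcases hρmem T with h | ⟨x, hx, -⟩
    · exact h
    · exfalso
      have h1 : ENNReal.ofReal (K ^ (J + (T + 1))) ≤ v a := hx.2.trans (ha hx.1)
      rw [ENNReal.ofReal_le_iff_le_toReal (hfin a haQ).ne] at h1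
      have h2 : K ^ T ≤ K ^ (J + (T + 1)) := pow_le_pow_right₀ hK.le (by omega)
      linarith
  have hlt : ∀ j, ∀ x ∈ Metric.ball x₀ (ρ j), v x ≤ ENNReal.ofReal (K ^ (J + (j + 1))) := by
    intro j x hx
    rw [Metric.mem_ball] at hx
    by_contra! h
    have hxQ : x ∈ Q := Metric.mem_closedBall.2 (hx.le.trans (hρd j))
    exact absurd (hρle j _ (mem_insert_of_mem _ ⟨x, ⟨hxQ, h.le⟩, rfl⟩)) (not_le.2 hx)
  let ann : ℕ → Set (EuclideanSpace ℝ (Fin N)) := fun j =>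
    (fun x => dist x x₀) ⁻¹' Ico (ρ j) (ρ (j + 1))
  have hannm : ∀ j, MeasurableSet (ann j) := fun j =>
    (by fun_prop : Measurable fun x => dist x x₀) measurableSet_Ico
  have hannQ : ∀ j, ann j ⊆ Q := fun j x hx =>
    Metric.mem_closedBall.2 (hx.2.le.trans (hρd _))
  -- the estimate on one annulus
  have hstep : ∀ j, A j * ENNReal.ofReal (ρ (j + 1) - ρ j) ^ N ≤
      chainConst N K * ∫⁻ x in ann j, W x := by
    intro j
    rcases (hρmono (Nat.le_succ j)).eq_or_lt with h | h
    · have : N ≠ 0 := by omega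
      rw [Nat.succ_eq_add_one] at h
      simp [← h, this]
    rw [Nat.succ_eq_add_one] at h
    set R := ρ (j + 1) - ρ j with hR
    have hRpos : 0 < R := sub_pos.2 h
    obtain ⟨x₁, hx₁, hx₁ρ⟩ : ∃ x₁ ∈ S (j + 1), dist x₁ x₀ = ρ j := by
      rcases hρmem j with h' | h'
      · exact absurd (h'.symm.le.trans_lt h) (not_lt.2 (hρd _))
      · exact h'
    have hBQ : Metric.closedBall x₁ R ⊆ Q := Metric.closedBall_subset_closedBall' (by
      rw [hx₁ρ, hR]; linarith [hρd (j + 1)])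
    have e1 : K ^ (J + (j + 1)) = K * K ^ (J + j) := by ring
    have e2 : K ^ (J + (j + 1 + 1)) = K * (K * K ^ (J + j)) := by ring
    have hvol := volume_ball_le_volume_annulus (v := v) (x₀ := x₀) (x₁ := x₁) (R := R)
      (L := K ^ (J + j)) hK (by positivity)
      (by
        rw [← e1]
        exact (mul_le_mul_right hx₁.2 _).trans (hsub x₁ R hRpos hBQ))
      (by rw [hx₁ρ, ← e1]; exact hlt j)
      (by rw [hx₁ρ, ← e2, hR, add_sub_cancel]; exact hlt (j + 1))
      (hSc j).isClosed.measurableSet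
      (fun x hx hxS => by
        by_contra! h
        exact hxS ⟨hBQ (Metric.ball_subset_closedBall hx), h.le⟩)
    rw [hx₁ρ, hR, add_sub_cancel, ← hR, Measure.addHaar_ball _ _ hRpos.le,
      finrank_euclideanSpace_fin, ENNReal.ofReal_pow hRpos.le] at hvol
    have hW : A j * volume (S j ∩ ann j) ≤ ∫⁻ x in ann j, W x := by
      rw [← setLIntegral_const]
      calc ∫⁻ _ in S j ∩ ann j, A j ≤ ∫⁻ x in S j ∩ ann j, W x := by
            refine setLIntegral_mono_ae' ((hSc j).isClosed.measurableSet.inter (hannm j)) ?_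
            filter_upwards [hAW] with x hx hxS
            exact hx hxS.1.1 j hxS.1.2
        _ ≤ _ := lintegral_mono_set inter_subset_right
    have hν0 : volume (Metric.ball (0 : EuclideanSpace ℝ (Fin N)) 1) ≠ 0 :=
      (Metric.measure_ball_pos _ _ one_pos).ne'
    have hνt : volume (Metric.ball (0 : EuclideanSpace ℝ (Fin N)) 1) ≠ ∞ :=
      measure_ball_lt_top.ne
    rw [chainConst, ← ENNReal.mul_div_right_comm,
      ENNReal.le_div_iff_mul_le (Or.inl hν0) (Or.inl hνt), mul_assoc]
    calc _ ≤ A j * (ENNReal.ofReal (2 * K ^ 2 / (K - 1)) * volume (S j ∩ ann j)) :=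
          mul_le_mul_right hvol _
      _ = ENNReal.ofReal (2 * K ^ 2 / (K - 1)) * (A j * volume (S j ∩ ann j)) := by ring
      _ ≤ _ := mul_le_mul_right hW _
  have hsum : ∑ j ∈ Finset.range T, A j * ENNReal.ofReal (ρ (j + 1) - ρ j) ^ N ≤
      chainConst N K * ∫⁻ x in Q, W x := by
    refine (Finset.sum_le_sum fun j _ => hstep j).trans ?_
    rw [← Finset.mul_sum]
    refine mul_le_mul_right ?_ _
    rw [← lintegral_biUnion_finset (fun i _ j _ hij => ?_) (fun j _ => hannm j)]
    · exact lintegral_mono_set (iUnion₂_subset fun j _ => hannQ j)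
    · exact (hρmono.pairwise_disjoint_on_Ico_succ hij).preimage _
  calc ENNReal.ofReal d = ∑ j ∈ Finset.range T, ENNReal.ofReal (ρ (j + 1) - ρ j) := by
        rw [← ENNReal.ofReal_sum_of_nonneg fun j _ => sub_nonneg.2 (hρmono (Nat.le_succ j)),
          Finset.sum_range_sub, hT, hρ0, sub_zero]
    _ ≤ _ := sum_le_of_weights hN _ _ A hA0 hAt
    _ ≤ _ := mul_le_mul' (ENNReal.rpow_le_rpow hsum (by positivity))
        (ENNReal.rpow_le_rpow (ENNReal.sum_le_tsum _)
          (div_nonneg (by linarith) (by positivity)))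

/-! ### A Hardy inequality for nonincreasing functions -/

lemma ENNReal.tsum_rpow_le {ι : Type*} (f : ι → ℝ≥0∞) {p : ℝ} (hp : 0 < p) (hp1 : p ≤ 1) :
    (∑' i, f i) ^ p ≤ ∑' i, f i ^ p := by
  have hfin : ∀ s : Finset ι, (∑ i ∈ s, f i) ^ p ≤ ∑ i ∈ s, f i ^ p := fun s => by
    classical
    induction s using Finset.induction_on with
    | empty => simp [hp]
    | insert a s ha ih =>
      rw [Finset.sum_insert ha, Finset.sum_insert ha]
      exact (ENNReal.rpow_add_le_add_rpow _ _ hp.le hp1).trans (add_le_add le_rfl ih)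
  refine le_of_tendsto ((ENNReal.continuous_rpow_const (y := p)).tendsto _ |>.comp
    ENNReal.summable.hasSum) (Filter.Eventually.of_forall fun s => ?_)
  exact (hfin s).trans (ENNReal.sum_le_tsum s)

lemma setLIntegral_Ioi_comp_mul_left (G : ℝ → ℝ≥0∞) {a : ℝ} (ha : 0 < a) :
    ENNReal.ofReal a * ∫⁻ s in Ioi 1, G (a * s) = ∫⁻ s in Ioi a, G s := by
  have hemb : MeasurableEmbedding (fun s : ℝ => a * s) :=
    (Homeomorph.mulLeft₀ a ha.ne').measurableEmbedding
  have hpre : (fun s : ℝ => a * s) ⁻¹' Ioi a = Ioi 1 := by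
    ext s
    simp [div_self ha.ne', ha]
  conv_rhs => rw [← Real.smul_map_volume_mul_left ha.ne', abs_of_pos ha]
  rw [Measure.restrict_smul, lintegral_smul_measure, hemb.restrict_map, hemb.lintegral_map, hpre,
    smul_eq_mul]

/-- A Hardy inequality for nonincreasing functions and exponents `p ≤ 1`. -/
lemma lintegral_rpow_lintegral_Ioi_le {h : ℝ → ℝ≥0∞} (hh : AntitoneOn h (Ioi 0)) {p : ℝ}
    (hp : 0 < p) (hp1 : p ≤ 1) :
    ∫⁻ s in Ioi 1, (∫⁻ t in Ioi s, h t) ^ p ≤ 2 * ∫⁻ s in Ioi 1, (ENNReal.ofReal s * h s) ^ p := by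
  set G : ℝ → ℝ≥0∞ := fun s => (ENNReal.ofReal s * h s) ^ p with hG
  have hpow : ∀ k : ℕ, (0 : ℝ) < 2 ^ k := fun k => by positivity
  -- split the inner integral at the points `2 ^ k * s`
  have h1 : ∀ s ∈ Ioi (1 : ℝ), (∫⁻ t in Ioi s, h t) ^ p ≤ ∑' k : ℕ, G (2 ^ k * s) := by
    intro s hs
    have hs0 : 0 < s := one_pos.trans hs
    refine le_trans ?_ (ENNReal.tsum_rpow_le _ hp hp1)
    refine ENNReal.rpow_le_rpow ?_ hp.le
    have hcover : Ioi s ⊆ ⋃ k : ℕ, Ico (2 ^ k * s) (2 ^ (k + 1) * s) := by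
      intro t ht
      obtain ⟨k, hk, hk'⟩ := exists_nat_pow_near ((one_le_div hs0).2 (mem_Ioi.1 ht).le)
        one_lt_two
      exact mem_iUnion.2 ⟨k, (le_div_iff₀ hs0).1 hk, (div_lt_iff₀ hs0).1 hk'⟩
    refine (lintegral_mono_set hcover).trans ((lintegral_iUnion_le _ _).trans ?_)
    refine ENNReal.tsum_le_tsum fun k => ?_
    have hks : 0 < 2 ^ k * s := mul_pos (hpow k) hs0
    calc ∫⁻ t in Ico (2 ^ k * s) (2 ^ (k + 1) * s), h t
        ≤ ∫⁻ t in Ico (2 ^ k * s) (2 ^ (k + 1) * s), h (2 ^ k * s) :=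
          setLIntegral_mono' measurableSet_Ico fun t ht =>
            hh hks (hks.trans_le ht.1) ht.1
      _ = ENNReal.ofReal (2 ^ k * s) * h (2 ^ k * s) := by
          rw [setLIntegral_const, Real.volume_Ico, mul_comm]
          congr 2
          ring
  have hmeas : ∀ k : ℕ, AEMeasurable (fun s => G (2 ^ k * s)) (volume.restrict (Ioi 1)) := by
    intro k
    have h2 : AntitoneOn (fun s => h (2 ^ k * s)) (Ioi 1) := fun a ha b hb hab =>
      hh (mul_pos (hpow k) (one_pos.trans ha)) (mul_pos (hpow k) (one_pos.trans hb))
        (mul_le_mul_of_nonneg_left hab (hpow k).le)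
    have h3 := aemeasurable_restrict_of_antitoneOn (μ := volume) measurableSet_Ioi h2
    exact ((by fun_prop : AEMeasurable (fun s : ℝ => ENNReal.ofReal (2 ^ k * s))
      (volume.restrict (Ioi 1))).mul h3).pow_const p
  have h4 : ∀ k : ℕ, ∫⁻ s in Ioi 1, G (2 ^ k * s) ≤ 2⁻¹ ^ k * ∫⁻ s in Ioi 1, G s := by
    intro k
    have h5 := setLIntegral_Ioi_comp_mul_left G (hpow k)
    have h6 : ∫⁻ s in Ioi (2 ^ k : ℝ), G s ≤ ∫⁻ s in Ioi 1, G s :=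
      lintegral_mono_set (Ioi_subset_Ioi (one_le_pow₀ one_le_two))
    rw [← h5, ENNReal.ofReal_pow zero_le_two, ENNReal.ofReal_ofNat] at h6
    rw [← ENNReal.inv_pow, mul_comm, ← div_eq_mul_inv,
      ENNReal.le_div_iff_mul_le (by simp) (by simp), mul_comm]
    exact h6
  calc ∫⁻ s in Ioi 1, (∫⁻ t in Ioi s, h t) ^ p
      ≤ ∫⁻ s in Ioi 1, ∑' k : ℕ, G (2 ^ k * s) := setLIntegral_mono' measurableSet_Ioi h1
    _ = ∑' k : ℕ, ∫⁻ s in Ioi 1, G (2 ^ k * s) := lintegral_tsum hmeas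
    _ ≤ ∑' k : ℕ, 2⁻¹ ^ k * ∫⁻ s in Ioi 1, G s := ENNReal.tsum_le_tsum h4
    _ = 2 * ∫⁻ s in Ioi 1, G s := by
        rw [ENNReal.tsum_mul_right, ENNReal.tsum_geometric, ENNReal.one_sub_inv_two, inv_inv]

lemma tsum_le_lintegral_Ioi {f : ℝ → ℝ≥0∞} (hf : AntitoneOn f (Ioi 0)) {a : ℝ} (ha : 0 ≤ a) :
    ∑' j : ℕ, f (a + 1 + j) ≤ ∫⁻ s in Ioi a, f s := by
  have hmono : Monotone fun j : ℕ => a + j := fun i j hij => by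
    simpa using hij
  calc ∑' j : ℕ, f (a + 1 + j) ≤ ∑' j : ℕ, ∫⁻ s in Ioc (a + j) (a + (j + 1 : ℕ)), f s := by
        refine ENNReal.tsum_le_tsum fun j => ?_
        have hj : (0 : ℝ) ≤ a + j := by positivity
        calc f (a + 1 + j) = ∫⁻ s in Ioc (a + j) (a + (j + 1 : ℕ)), f (a + 1 + j) := by
              rw [setLIntegral_const, Real.volume_Ioc]
              simp
          _ ≤ _ := setLIntegral_mono' measurableSet_Ioc fun s hs =>
              hf (hj.trans_lt hs.1) (by rw [mem_Ioi]; linarith)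
                (hs.2.trans (by push_cast; linarith))
    _ = ∫⁻ s in ⋃ j : ℕ, Ioc (a + j) (a + (j + 1 : ℕ)), f s :=
        (lintegral_iUnion (fun j => measurableSet_Ioc) hmono.pairwise_disjoint_on_Ioc_succ _).symm
    _ ≤ ∫⁻ s in Ioi a, f s := by
        refine lintegral_mono_set (iUnion_subset fun j s hs => ?_)
        have : (0 : ℝ) ≤ j := j.cast_nonneg
        exact lt_of_le_of_lt (by linarith) hs.1

/-- The discrete form of the Hardy inequality: iterated tail sums converge. -/
lemma tsum_rpow_tsum_ne_top {h : ℝ → ℝ≥0∞} (hh : AntitoneOn h (Ioi 0)) {p : ℝ}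
    (hp : 0 < p) (hp1 : p ≤ 1) (hint : ∫⁻ s in Ioi 1, (ENNReal.ofReal s * h s) ^ p ≠ ∞) :
    ∑' i : ℕ, (∑' j : ℕ, h (i + 3 + j)) ^ p ≠ ∞ := by
  have hH : AntitoneOn (fun s => (∫⁻ t in Ioi s, h t) ^ p) (Ioi 0) := fun a _ b _ hab =>
    ENNReal.rpow_le_rpow (lintegral_mono_set (Ioi_subset_Ioi hab)) hp.le
  refine ne_top_of_le_ne_top (ENNReal.mul_ne_top ENNReal.ofNat_ne_top hint)
    (le_trans ?_ (lintegral_rpow_lintegral_Ioi_le hh hp hp1))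
  refine le_trans (ENNReal.tsum_le_tsum fun i => ?_) (tsum_le_lintegral_Ioi hH zero_le_one)
  refine ENNReal.rpow_le_rpow ?_ hp.le
  have := tsum_le_lintegral_Ioi hh (a := 1 + 1 + (i : ℝ)) (by positivity)
  convert this using 4
  ring

/-! ### The product structure, and joint upper semicontinuity -/

lemma joinPt_eq_finAddEquivProd_symm {m n : ℕ}
    (p : EuclideanSpace ℝ (Fin m) × EuclideanSpace ℝ (Fin n)) :
    joinPt p.1 p.2 = EuclideanSpace.finAddEquivProd.symm p := by
  rw [ContinuousLinearEquiv.eq_symm_apply]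
  ext i <;> simp [joinPt]

lemma continuous_joinPt {m n : ℕ} : Continuous
    (fun p : EuclideanSpace ℝ (Fin m) × EuclideanSpace ℝ (Fin n) => joinPt p.1 p.2) := by
  simp_rw [joinPt_eq_finAddEquivProd_symm]
  fun_prop

lemma measurableEmbedding_joinPt {m n : ℕ} : MeasurableEmbedding
    (fun p : EuclideanSpace ℝ (Fin m) × EuclideanSpace ℝ (Fin n) => joinPt p.1 p.2) := by
  simp_rw [joinPt_eq_finAddEquivProd_symm]
  exact EuclideanSpace.finAddEquivProd.symm.toHomeomorph.measurableEmbedding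

lemma exists_joinPt_eq {m n : ℕ} (z : EuclideanSpace ℝ (Fin (m + n))) :
    ∃ (x : EuclideanSpace ℝ (Fin m)) (y : EuclideanSpace ℝ (Fin n)), joinPt x y = z :=
  ⟨_, _, (joinPt_eq_finAddEquivProd_symm (EuclideanSpace.finAddEquivProd z)).trans
    (ContinuousLinearEquiv.symm_apply_apply _ z)⟩

lemma measurePreserving_joinPt {m n : ℕ} : MeasurePreserving
    (fun p : EuclideanSpace ℝ (Fin m) × EuclideanSpace ℝ (Fin n) => joinPt p.1 p.2) := by
  have h1 := WithLp.volume_preserving_toLp (EuclideanSpace ℝ (Fin m)) (EuclideanSpace ℝ (Fin n))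
  have h2 := (PiLp.sumPiLpEquivProdLpPiLp (𝕜 := ℝ) (ι := Fin m) (κ := Fin n) 2
    (fun _ => ℝ)).symm.measurePreserving
  have h3 := (LinearIsometryEquiv.piLpCongrLeft 2 ℝ ℝ
    (finSumFinEquiv (m := m) (n := n)).symm).symm.measurePreserving
  convert h3.comp (h2.comp h1) using 1
  ext1 p
  exact joinPt_eq_finAddEquivProd_symm p

lemma dist_joinPt_sq {m n : ℕ} (x x' : EuclideanSpace ℝ (Fin m)) (y y' : EuclideanSpace ℝ (Fin n)) :
    dist (joinPt x y) (joinPt x' y') ^ 2 = dist x x' ^ 2 + dist y y' ^ 2 := by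
  simp only [EuclideanSpace.dist_eq, joinPt]
  rw [Real.sq_sqrt (by positivity), Real.sq_sqrt (by positivity), Real.sq_sqrt (by positivity),
    Fin.sum_univ_add]
  simp

lemma IsSubharmonicOn.lintegral_ball_le {N : ℕ} {u : EuclideanSpace ℝ (Fin N) → EReal}
    {D : Set (EuclideanSpace ℝ (Fin N))} (hu : IsSubharmonicOn u D)
    {x : EuclideanSpace ℝ (Fin N)} {r M : ℝ} (hr : 0 < r) (hM : 0 ≤ M)
    (hD : Metric.closedBall x r ⊆ D) (huM : ∀ y ∈ Metric.ball x r, u y ≤ M) :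
    ∫⁻ y in Metric.ball x r, ((M : EReal) - u y).toENNReal ≤
      volume (Metric.ball x r) * ((M : EReal) - u x).toENNReal :=
  (le_ballMean_iff hr hM huM (hu.upperSemicontinuousOn.aemeasurable_restrict measurableSet_ball
    (Metric.ball_subset_closedBall.trans hD))).1 (hu.le_ballMean x r hr hD)

lemma EReal.toENNReal_sub_anti {M a b : EReal} (h : a ≤ b) :
    (M - b).toENNReal ≤ (M - a).toENNReal :=
  EReal.toENNReal_le_toENNReal (EReal.sub_le_sub le_rfl h)

/-- A function on a product which is subharmonic in the first variable, upper semicontinuous in the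
second one and locally bounded above is upper semicontinuous in both variables jointly: by Fatou's
lemma its means over balls in the first variable are jointly upper semicontinuous, and they
majorize it. -/
lemma IsSeparatelySubharmonicOn.upperSemicontinuousAt {m n : ℕ}
    {u : EuclideanSpace ℝ (Fin (m + n)) → EReal} {Ω : Set (EuclideanSpace ℝ (Fin (m + n)))}
    (hu : IsSeparatelySubharmonicOn u Ω) (hΩ : IsOpen Ω) {x₀ : EuclideanSpace ℝ (Fin m)}
    {y₀ : EuclideanSpace ℝ (Fin n)} (h₀ : joinPt x₀ y₀ ∈ Ω) {M : ℝ} (hM : 0 ≤ M)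
    (hbdd : ∀ᶠ p in nhds (x₀, y₀), u (joinPt p.1 p.2) ≤ M) :
    UpperSemicontinuousAt (fun p : EuclideanSpace ℝ (Fin m) × EuclideanSpace ℝ (Fin n) =>
      u (joinPt p.1 p.2)) (x₀, y₀) := by
  intro c hc
  dsimp only at hc ⊢
  rcases lt_or_ge (M : EReal) c with hMc | hcM
  · exact hbdd.mono fun p hp => hp.trans_lt hMc
  by_contra hcon
  -- a real level strictly between `u (x₀, y₀)` and `c`
  obtain ⟨c', hc1, hc2⟩ := EReal.lt_iff_exists_real_btwn.1 hc
  have hγ : ((M : EReal) - c).toENNReal < ((M : EReal) - c').toENNReal := by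
    induction c using EReal.rec with
    | bot => simp at hc2
    | top => simp at hcM
    | coe c =>
      rw [EReal.coe_lt_coe_iff] at hc2
      rw [EReal.coe_le_coe_iff] at hcM
      rw [← EReal.coe_sub, ← EReal.coe_sub, EReal.real_coe_toENNReal, EReal.real_coe_toENNReal]
      exact (ENNReal.ofReal_lt_ofReal_iff (by linarith)).2 (by linarith)
  have hopen : ∀ᶠ p in nhds (x₀, y₀), joinPt p.1 p.2 ∈ Ω ∧ u (joinPt p.1 p.2) ≤ M :=
    (continuous_joinPt.continuousAt.eventually (hΩ.mem_nhds h₀)).and hbdd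
  obtain ⟨ε, hε, hεP⟩ := Metric.nhds_basis_closedBall.eventually_iff.1 hopen
  have hleft : ∀ᶠ x in nhds x₀, u (joinPt x y₀) < c' := by
    have hD : IsOpen {x | joinPt x y₀ ∈ Ω} := hΩ.preimage (continuous_joinPt.comp (by fun_prop :
      Continuous fun x : EuclideanSpace ℝ (Fin m) => (x, y₀)))
    have := (hu.left y₀).upperSemicontinuousOn x₀ h₀ c' hc1
    rwa [hD.nhdsWithin_eq h₀] at this
  obtain ⟨r₁, hr₁, hr₁P⟩ := Metric.nhds_basis_ball.eventually_iff.1 hleft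
  set r := min r₁ (ε / 2)
  have hr : 0 < r := lt_min hr₁ (by linarith)
  have hrε : r ≤ ε / 2 := min_le_right _ _
  obtain ⟨p, hp, hpP⟩ := Filter.exists_seq_forall_of_frequently
    ((Filter.not_eventually.1 hcon).and_eventually (Metric.closedBall_mem_nhds (x₀, y₀)
      (half_pos hε)))
  have hpc : ∀ k, c ≤ u (joinPt (p k).1 (p k).2) := fun k => not_lt.1 (hpP k).1
  have hpx : ∀ k, dist (p k).1 x₀ ≤ ε / 2 := fun k => (le_max_left _ _).trans (hpP k).2
  have hpy : ∀ k, dist (p k).2 y₀ ≤ ε / 2 := fun k => (le_max_right _ _).trans (hpP k).2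
  have hpx_lim := hp.fst_nhds
  have hpy_lim := hp.snd_nhds
  have hin : ∀ k, ∀ ξ ∈ Metric.closedBall (p k).1 r,
      joinPt ξ (p k).2 ∈ Ω ∧ u (joinPt ξ (p k).2) ≤ M := by
    intro k ξ hξ
    refine @hεP (ξ, (p k).2) ?_
    rw [Metric.mem_closedBall] at hξ ⊢
    refine max_le ?_ ((hpy k).trans (by linarith))
    dsimp only
    linarith [dist_triangle ξ (p k).1 x₀, hpx k]
  let f : ℕ → EuclideanSpace ℝ (Fin m) → ℝ≥0∞ := fun k =>
    (Metric.ball (p k).1 r).indicator fun ξ => ((M : EReal) - u (joinPt ξ (p k).2)).toENNReal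
  have hfm : ∀ k, AEMeasurable (f k) volume := fun k => by
    refine (aemeasurable_indicator_iff measurableSet_ball).2 ?_
    refine measurable_ereal_toENNReal.comp_aemeasurable ?_
    have h1 := (hu.left (p k).2).upperSemicontinuousOn.aemeasurable_restrict (μ := volume)
      (measurableSet_ball (x := (p k).1) (ε := r))
      (fun ξ hξ => (hin k ξ (Metric.ball_subset_closedBall hξ)).1)
    exact aemeasurable_const.sub h1
  have hball : ∀ x : EuclideanSpace ℝ (Fin m),
      volume (Metric.ball x r) = volume (Metric.ball x₀ r) := fun x => by
    rw [Measure.addHaar_ball_center, Measure.addHaar_ball_center volume x₀]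
  have hupper : ∀ k, ∫⁻ ξ, f k ξ ≤ volume (Metric.ball x₀ r) * ((M : EReal) - c).toENNReal := by
    intro k
    rw [lintegral_indicator measurableSet_ball, ← hball (p k).1]
    refine ((hu.left (p k).2).lintegral_ball_le hr hM (fun ξ hξ => (hin k ξ hξ).1)
      (fun ξ hξ => (hin k ξ (Metric.ball_subset_closedBall hξ)).2)).trans ?_
    exact mul_le_mul_right (EReal.toENNReal_sub_anti (hpc k)) _
  have hlower : ∀ ξ ∈ Metric.ball x₀ r,
      ((M : EReal) - c').toENNReal ≤ Filter.liminf (fun k => f k ξ) Filter.atTop := by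
    intro ξ hξ
    refine Filter.le_liminf_of_le (by isBoundedDefault) ?_
    have hξc : u (joinPt ξ y₀) < c' := hr₁P (Metric.ball_subset_ball (min_le_left _ _) hξ)
    have hξΩ : joinPt ξ y₀ ∈ Ω := by
      refine (@hεP (ξ, y₀) ?_).1
      rw [Metric.mem_ball] at hξ
      rw [Metric.mem_closedBall]
      refine max_le ?_ (by simp [hε.le])
      dsimp only
      linarith
    have hright : ∀ᶠ y in nhds y₀, u (joinPt ξ y) < c' := by
      have hD : IsOpen {y | joinPt ξ y ∈ Ω} := hΩ.preimage (continuous_joinPt.comp (by fun_prop :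
        Continuous fun y : EuclideanSpace ℝ (Fin n) => (ξ, y)))
      have := (hu.right ξ).upperSemicontinuousOn y₀ hξΩ c' hξc
      rwa [hD.nhdsWithin_eq hξΩ] at this
    have hmem : ∀ᶠ x in nhds x₀, ξ ∈ Metric.ball x r := by
      filter_upwards [Metric.isOpen_ball.mem_nhds (Metric.mem_ball_comm.1 hξ)] with x hx
      exact Metric.mem_ball_comm.1 hx
    filter_upwards [hpx_lim.eventually hmem, hpy_lim.eventually hright] with k h1 h2
    change _ ≤ (Metric.ball (p k).1 r).indicator _ ξ
    rw [indicator_of_mem h1]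
    exact EReal.toENNReal_sub_anti h2.le
  have hfatou := lintegral_liminf_le' (μ := volume) (u := Filter.atTop) hfm
  have hge : ((M : EReal) - c').toENNReal * volume (Metric.ball x₀ r) ≤
      ∫⁻ ξ, Filter.liminf (fun k => f k ξ) Filter.atTop := by
    rw [← setLIntegral_const]
    exact (setLIntegral_mono' measurableSet_ball hlower).trans (setLIntegral_le_lintegral _ _)
  have hle : Filter.liminf (fun k => ∫⁻ ξ, f k ξ) Filter.atTop ≤
      volume (Metric.ball x₀ r) * ((M : EReal) - c).toENNReal :=
    (Filter.liminf_le_liminf (Filter.Eventually.of_forall hupper)).trans (by simp)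
  have hfinal := hge.trans (hfatou.trans hle)
  rw [mul_comm] at hfinal
  exact absurd ((ENNReal.mul_le_mul_iff_right (Metric.measure_ball_pos volume x₀ hr).ne'
    measure_ball_lt_top.ne).1 hfinal) (not_le.2 hγ)

/-! ### The sub-mean value inequality on balls of the product -/

lemma dist_joinPt_lt_iff {m n : ℕ} {x ξ : EuclideanSpace ℝ (Fin m)}
    {y η : EuclideanSpace ℝ (Fin n)} {r : ℝ} (hr : 0 < r) :
    dist (joinPt ξ η) (joinPt x y) < r ↔ dist ξ x ^ 2 + dist η y ^ 2 < r ^ 2 := by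
  rw [← dist_joinPt_sq]
  exact (pow_lt_pow_iff_left₀ dist_nonneg hr.le two_ne_zero).symm

lemma dist_joinPt_le_iff {m n : ℕ} {x ξ : EuclideanSpace ℝ (Fin m)}
    {y η : EuclideanSpace ℝ (Fin n)} {r : ℝ} (hr : 0 < r) :
    dist (joinPt ξ η) (joinPt x y) ≤ r ↔ dist ξ x ^ 2 + dist η y ^ 2 ≤ r ^ 2 := by
  rw [← dist_joinPt_sq]
  exact (pow_le_pow_iff_left₀ dist_nonneg hr.le two_ne_zero).symm

/-- The set `dist ξ x ^ 2 + q ^ 2 < r ^ 2` is the slice of a ball of radius `r` at distance `q` from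
its centre. It is empty or a ball centred at `x`, so the super-mean value inequality for balls of
that radius lets one replace `w` by its value at `x` in the integral over it. -/
lemma lintegral_slice_le {N : ℕ} {w : EuclideanSpace ℝ (Fin N) → ℝ≥0∞}
    {x : EuclideanSpace ℝ (Fin N)} {q r : ℝ}
    (h : ∀ ρ, 0 < ρ → ρ ^ 2 + q ^ 2 = r ^ 2 →
      ∫⁻ ξ in Metric.ball x ρ, w ξ ≤ volume (Metric.ball x ρ) * w x) :
    ∫⁻ ξ, {ξ | dist ξ x ^ 2 + q ^ 2 < r ^ 2}.indicator w ξ ≤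
      ∫⁻ ξ, {ξ | dist ξ x ^ 2 + q ^ 2 < r ^ 2}.indicator (fun _ => w x) ξ := by
  rcases le_or_gt (r ^ 2) (q ^ 2) with hq | hq
  · have : {ξ | dist ξ x ^ 2 + q ^ 2 < r ^ 2} = ∅ := by
      ext ξ
      simp only [mem_ofPred_eq, mem_empty_iff_false, iff_false, not_lt]
      nlinarith [sq_nonneg (dist ξ x)]
    simp [this]
  · set ρ := √(r ^ 2 - q ^ 2)
    have hρ : 0 < ρ := Real.sqrt_pos.2 (by linarith)
    have hρ2 : ρ ^ 2 = r ^ 2 - q ^ 2 := Real.sq_sqrt (by linarith)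
    have : {ξ | dist ξ x ^ 2 + q ^ 2 < r ^ 2} = Metric.ball x ρ := by
      ext ξ
      rw [mem_ofPred_eq, Metric.mem_ball, ← pow_lt_pow_iff_left₀ dist_nonneg hρ.le two_ne_zero, hρ2,
        lt_sub_iff_add_lt]
    rw [this, lintegral_indicator measurableSet_ball, lintegral_indicator measurableSet_ball,
      setLIntegral_const, mul_comm (w x)]
    exact h ρ hρ (by linarith)

/-- An upper semicontinuous separately subharmonic function has the sub-mean value property on
balls of the product: the slices of a ball parallel to either factor are balls, so that Tonelli's
theorem reduces the claim to the two partial sub-mean value properties, applied one after the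
other. -/
lemma IsSeparatelySubharmonicOn.le_ballMean {m n : ℕ}
    {u : EuclideanSpace ℝ (Fin (m + n)) → EReal} {Ω : Set (EuclideanSpace ℝ (Fin (m + n)))}
    (hu : IsSeparatelySubharmonicOn u Ω) (husc : UpperSemicontinuousOn u Ω)
    {z : EuclideanSpace ℝ (Fin (m + n))} {r : ℝ} (hr : 0 < r)
    (hz : Metric.closedBall z r ⊆ Ω) : u z ≤ ballMean u z r := by
  obtain ⟨x, y, rfl⟩ := exists_joinPt_eq z
  have hlt : ∀ z ∈ Ω, u z < ⊤ := fun z hz => by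
    obtain ⟨x, y, rfl⟩ := exists_joinPt_eq z
    exact (hu.left y).lt_top x hz
  obtain ⟨M, hM, hMu⟩ : ∃ M : ℝ, 0 ≤ M ∧ ∀ z' ∈ Metric.closedBall (joinPt x y) r, u z' ≤ M := by
    obtain ⟨a, ha, hmax⟩ := (husc.mono hz).exists_isMaxOn
      ⟨_, Metric.mem_closedBall_self hr.le⟩ (isCompact_closedBall _ _)
    refine ⟨max (u a).toReal 0, le_max_right _ _, fun z' hz' => (hmax hz').trans ?_⟩
    exact (EReal.le_coe_toReal (hlt a (hz ha)).ne).trans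
      (EReal.coe_le_coe_iff.2 (le_max_left _ _))
  have humeas := husc.aemeasurable_restrict (μ := volume)
    (measurableSet_ball (x := joinPt x y) (ε := r)) (Metric.ball_subset_closedBall.trans hz)
  rw [le_ballMean_iff hr hM (fun z' hz' => hMu z' (Metric.ball_subset_closedBall hz')) humeas]
  set P : Set (EuclideanSpace ℝ (Fin m) × EuclideanSpace ℝ (Fin n)) :=
    (fun p => joinPt p.1 p.2) ⁻¹' Metric.ball (joinPt x y) r
  have hPmem : ∀ ξ η, (ξ, η) ∈ P ↔ dist ξ x ^ 2 + dist η y ^ 2 < r ^ 2 := fun ξ η =>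
    dist_joinPt_lt_iff hr
  have hPm : MeasurableSet P := measurableEmbedding_joinPt.measurable measurableSet_ball
  have hball : ∀ ξ η, dist ξ x ^ 2 + dist η y ^ 2 ≤ r ^ 2 →
      joinPt ξ η ∈ Metric.closedBall (joinPt x y) r := fun ξ η h => (dist_joinPt_le_iff hr).2 h
  let w : EuclideanSpace ℝ (Fin m) → EuclideanSpace ℝ (Fin n) → ℝ≥0∞ := fun ξ η =>
    ((M : EReal) - u (joinPt ξ η)).toENNReal
  -- `w` with its first variable free, or frozen at the centre
  let F : EuclideanSpace ℝ (Fin m) × EuclideanSpace ℝ (Fin n) → ℝ≥0∞ :=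
    P.indicator fun p => w p.1 p.2
  let G : EuclideanSpace ℝ (Fin m) × EuclideanSpace ℝ (Fin n) → ℝ≥0∞ :=
    P.indicator fun p => w x p.2
  have hFm : AEMeasurable F (volume.prod volume) := by
    refine (aemeasurable_indicator_iff hPm).2 (measurable_ereal_toENNReal.comp_aemeasurable ?_)
    refine aemeasurable_const.sub (UpperSemicontinuousOn.aemeasurable_restrict (D := P) ?_ hPm
      subset_rfl)
    exact husc.comp continuous_joinPt.continuousOn
      fun p hp => hz (Metric.ball_subset_closedBall hp)
  have hGm : AEMeasurable G (volume.prod volume) := by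
    refine (aemeasurable_indicator_iff hPm).2 (measurable_ereal_toENNReal.comp_aemeasurable ?_)
    refine aemeasurable_const.sub (UpperSemicontinuousOn.aemeasurable_restrict (D := P) ?_ hPm
      subset_rfl)
    refine husc.comp (g := fun p : EuclideanSpace ℝ (Fin m) × EuclideanSpace ℝ (Fin n) =>
      joinPt x p.2) (continuous_joinPt.comp (by fun_prop : Continuous fun p :
        EuclideanSpace ℝ (Fin m) × EuclideanSpace ℝ (Fin n) => (x, p.2))).continuousOn ?_
    intro p hp
    refine hz (hball x p.2 ?_)
    have := (hPmem p.1 p.2).1 hp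
    rw [dist_self]
    nlinarith [sq_nonneg (dist p.1 x)]
  have hpre : ∀ f : EuclideanSpace ℝ (Fin (m + n)) → ℝ≥0∞,
      ∫⁻ z' in Metric.ball (joinPt x y) r, f z' = ∫⁻ p in P, f (joinPt p.1 p.2) := fun f =>
    (measurePreserving_joinPt.setLIntegral_comp_preimage_emb measurableEmbedding_joinPt f _).symm
  have hFG : ∀ η, ∫⁻ ξ, F (ξ, η) ≤ ∫⁻ ξ, G (ξ, η) := by
    intro η
    have h := lintegral_slice_le (w := fun ξ => w ξ η) (x := x) (q := dist η y) (r := r) (by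
      intro ρ hρ hρr
      have hsub : ∀ ξ ∈ Metric.closedBall x ρ, joinPt ξ η ∈ Metric.closedBall (joinPt x y) r :=
        fun ξ hξ => hball ξ η (by
          have := pow_le_pow_left₀ dist_nonneg (Metric.mem_closedBall.1 hξ) 2
          linarith)
      exact (hu.left η).lintegral_ball_le hρ hM (fun ξ hξ => hz (hsub ξ hξ))
        (fun ξ hξ => hMu _ (hsub ξ (Metric.ball_subset_closedBall hξ))))
    convert h using 2
    · ext ξ
      exact indicator_eq_indicator (hPmem ξ η) rfl
    · ext ξ
      exact indicator_eq_indicator (hPmem ξ η) rfl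
  have hGw : ∀ ξ, ∫⁻ η, G (ξ, η) ≤ ∫⁻ η, P.indicator (fun _ => w x y) (ξ, η) := by
    intro ξ
    have h := lintegral_slice_le (w := fun η => w x η) (x := y) (q := dist ξ x) (r := r) (by
      intro ρ hρ hρr
      have hsub : ∀ η ∈ Metric.closedBall y ρ, joinPt x η ∈ Metric.closedBall (joinPt x y) r :=
        fun η hη => hball x η (by
          have := pow_le_pow_left₀ dist_nonneg (Metric.mem_closedBall.1 hη) 2
          rw [dist_self]
          nlinarith [sq_nonneg (dist ξ x)])
      exact (hu.right x).lintegral_ball_le hρ hM (fun η hη => hz (hsub η hη))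
        (fun η hη => hMu _ (hsub η (Metric.ball_subset_closedBall hη))))
    convert h using 2
    · ext η
      exact indicator_eq_indicator ((hPmem ξ η).trans (by rw [add_comm]; rfl)) rfl
    · ext η
      exact indicator_eq_indicator ((hPmem ξ η).trans (by rw [add_comm]; rfl)) rfl
  calc ∫⁻ z' in Metric.ball (joinPt x y) r, ((M : EReal) - u z').toENNReal
      = ∫⁻ p, F p ∂(volume.prod volume) := by rw [hpre, ← lintegral_indicator hPm]; rfl
    _ = ∫⁻ η, ∫⁻ ξ, F (ξ, η) := lintegral_prod_symm _ hFm
    _ ≤ ∫⁻ η, ∫⁻ ξ, G (ξ, η) := lintegral_mono hFG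
    _ = ∫⁻ p, G p ∂(volume.prod volume) := (lintegral_prod_symm _ hGm).symm
    _ = ∫⁻ ξ, ∫⁻ η, G (ξ, η) := lintegral_prod _ hGm
    _ ≤ ∫⁻ ξ, ∫⁻ η, P.indicator (fun _ => w x y) (ξ, η) := lintegral_mono hGw
    _ = ∫⁻ p, P.indicator (fun _ => w x y) p ∂(volume.prod volume) :=
        (lintegral_prod _ (measurable_const.indicator hPm).aemeasurable).symm
    _ = ∫⁻ z' in Metric.ball (joinPt x y) r, w x y := by
        rw [hpre, ← lintegral_indicator hPm]; rfl
    _ = _ := by rw [setLIntegral_const, mul_comm]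

/-! ### Local boundedness -/

/-- The chain estimate for the positive part of a subharmonic function. -/
lemma IsSubharmonicOn.radius_le {N : ℕ} (hN : 2 ≤ N) {u : EuclideanSpace ℝ (Fin N) → EReal}
    {D : Set (EuclideanSpace ℝ (Fin N))} (hu : IsSubharmonicOn u D)
    {x₀ : EuclideanSpace ℝ (Fin N)} {d K : ℝ} (hd : 0 < d) (hK : 1 < K)
    (hD : Metric.closedBall x₀ d ⊆ D) {J : ℕ}
    (hJ : ENNReal.ofReal (K ^ (J + 1)) ≤ (u x₀).toENNReal)
    {W : EuclideanSpace ℝ (Fin N) → ℝ≥0∞} {A : ℕ → ℝ≥0∞}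
    (hA0 : ∀ j, A j ≠ 0) (hAt : ∀ j, A j ≠ ∞)
    (hAW : ∀ x ∈ Metric.closedBall x₀ d,
      ∀ j, ENNReal.ofReal (K ^ (J + j)) ≤ (u x).toENNReal → A j ≤ W x) :
    ENNReal.ofReal d ≤
      (chainConst N K * ∫⁻ x in Metric.closedBall x₀ d, W x) ^ (1 / (N : ℝ)) *
        (∑' j, A j ^ (-1 / ((N : ℝ) - 1))) ^ (((N : ℝ) - 1) / N) := by
  refine radius_le_of_chain (v := fun x => (u x).toENNReal) hN hd hK ?_ ?_ ?_ hJ hA0 hAt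
    (Filter.Eventually.of_forall hAW)
  · exact EReal.continuous_toENNReal.comp_upperSemicontinuousOn (hu.upperSemicontinuousOn.mono hD)
      fun a b h => EReal.toENNReal_le_toENNReal h
  · exact fun x hx => lt_top_iff_ne_top.2 (EReal.toENNReal_ne_top_iff.2 (hu.lt_top x (hD hx)).ne)
  · exact fun x ρ hρ hx => volume_ball_mul_toENNReal_le hρ (hu.le_ballMean x ρ hρ (hx.trans hD))

/-- The lower bound on the integral given by the chain estimate, where `δ` is the radius and `T` the
sum of the negative powers of the weights. -/
lemma div_le_of_le_rpow_mul_rpow {N : ℕ} (hN : 2 ≤ N) {δ C I T : ℝ≥0∞}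
    (h : δ ≤ (C * I) ^ (1 / (N : ℝ)) * T ^ (((N : ℝ) - 1) / N)) :
    δ ^ (N : ℝ) / (C * T ^ ((N : ℝ) - 1)) ≤ I := by
  have hN0 : (N : ℝ) ≠ 0 := by positivity
  refine ENNReal.div_le_of_le_mul ?_
  calc δ ^ (N : ℝ) ≤ ((C * I) ^ (1 / (N : ℝ)) * T ^ (((N : ℝ) - 1) / N)) ^ (N : ℝ) :=
        ENNReal.rpow_le_rpow h (by positivity)
    _ = I * (C * T ^ ((N : ℝ) - 1)) := by
        rw [ENNReal.mul_rpow_of_nonneg _ _ (by positivity), ← ENNReal.rpow_mul, ← ENNReal.rpow_mul,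
          one_div_mul_cancel hN0, div_mul_cancel₀ _ hN0, ENNReal.rpow_one]
        ring

lemma le_growth_of_le_toENNReal {φ : ℝ → ℝ} (hφ : StrictMonoOn φ (Ici 0)) {r : ℝ} (hr : 0 < r)
    {a : EReal} (ha : a ≠ ⊤) {k : ℕ} (h : ENNReal.ofReal (Real.exp (1 / r) ^ k) ≤ a.toENNReal) :
    φ k ≤ φ (Real.posLog ((max a 0).toReal ^ r)) := by
  refine hφ.monotoneOn (mem_Ici.2 k.cast_nonneg) (mem_Ici.2 Real.posLog_nonneg) ?_
  have hmax : a.toENNReal = ENNReal.ofReal (max a 0).toReal := by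
    rw [← EReal.toENNReal_of_ne_top (by simp [ha, max_eq_iff])]
    rw [← EReal.coe_ennreal_eq_coe_ennreal_iff, EReal.coe_toENNReal_eq_max,
      EReal.coe_toENNReal_eq_max, max_comm a 0, max_eq_right (le_max_left 0 a)]
  rw [hmax, ENNReal.ofReal_le_ofReal_iff' ] at h
  have hpos : 0 < Real.exp (1 / r) ^ k := by positivity
  have h1 : Real.exp (1 / r) ^ k ≤ (max a 0).toReal := h.resolve_right (not_le.2 hpos)
  have h2 : Real.exp k ≤ (max a 0).toReal ^ r := by
    calc Real.exp k = (Real.exp (1 / r) ^ k) ^ r := by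
          rw [← Real.exp_nat_mul, ← Real.exp_mul]
          congr 1
          field_simp
      _ ≤ _ := Real.rpow_le_rpow hpos.le h1 hr.le
  calc (k : ℝ) = Real.log (Real.exp k) := (Real.log_exp _).symm
    _ ≤ Real.log ((max a 0).toReal ^ r) := Real.log_le_log (Real.exp_pos _) h2
    _ ≤ _ := by rw [Real.posLog]; exact le_max_right _ _

/-- A separately subharmonic function whose positive part satisfies the growth condition is locally
bounded above. The chain estimate in the second variable bounds below the integrals
`I x = ∫ φ (log⁺ (u⁺ (x, y) ^ r)) dy` in terms of the supremum of `u (x, ·)`, and this bound serves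
as weight for the chain estimate in the first variable. Joint measurability of `u` is not available
at this stage; Tonelli's theorem only uses the a.e. measurability contained in the local
integrability condition. -/
lemma IsSeparatelySubharmonicOn.exists_eventually_le {m n : ℕ} (hn : 2 ≤ n) (hmn : n ≤ m)
    {Ω : Set (EuclideanSpace ℝ (Fin (m + n)))} (hΩ : IsOpen Ω)
    {u : EuclideanSpace ℝ (Fin (m + n)) → EReal} (hu : IsSeparatelySubharmonicOn u Ω)
    {φ : ℝ → ℝ} (hφ_mono : StrictMonoOn φ (Ici 0)) (hφ_surj : φ '' Ici 0 = Ici 0)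
    (hφ_int : IntegrableOn
      (fun s : ℝ => s ^ (((n : ℝ) - 1) / ((m : ℝ) - 1)) * φ s ^ (-1 / ((m : ℝ) - 1)))
      (Ioi 1) volume)
    {r : ℝ} (hr : 0 < r)
    (hu_int : LocallyIntegrableOn
      (fun z => φ (Real.posLog ((max (u z) 0).toReal ^ r))) Ω volume)
    {x₀ : EuclideanSpace ℝ (Fin m)} {y₀ : EuclideanSpace ℝ (Fin n)} (h₀ : joinPt x₀ y₀ ∈ Ω) :
    ∃ M : ℝ, 0 ≤ M ∧ ∀ᶠ p in nhds (x₀, y₀), u (joinPt p.1 p.2) ≤ M := by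
  have hm : 2 ≤ m := hn.trans hmn
  have hm1 : (0 : ℝ) < (m : ℝ) - 1 := by
    have : (2 : ℝ) ≤ m := by exact_mod_cast hm
    linarith
  have hn1 : (0 : ℝ) < (n : ℝ) - 1 := by
    have : (2 : ℝ) ≤ n := by exact_mod_cast hn
    linarith
  have hmn' : (n : ℝ) - 1 ≤ (m : ℝ) - 1 := by
    have : (n : ℝ) ≤ m := by exact_mod_cast hmn
    linarith
  have hφ_nonneg : ∀ s, 0 ≤ s → 0 ≤ φ s := fun s hs =>
    hφ_surj.subset (mem_image_of_mem φ (mem_Ici.2 hs))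
  have hφ_pos : ∀ s, 0 < s → 0 < φ s := fun s hs =>
    (hφ_nonneg 0 le_rfl).trans_lt (hφ_mono (mem_Ici.2 le_rfl) (mem_Ici.2 hs.le) hs)
  set p : ℝ := ((n : ℝ) - 1) / ((m : ℝ) - 1) with hp_def
  have hp : 0 < p := div_pos hn1 hm1
  have hp1 : p ≤ 1 := (div_le_one hm1).2 hmn'
  set K := Real.exp (1 / r)
  have hK : 1 < K := Real.one_lt_exp_iff.2 (by positivity)
  -- the tail sums of `φ ^ (-1 / (n - 1))`
  let h : ℝ → ℝ≥0∞ := fun s => ENNReal.ofReal (φ s) ^ (-1 / ((n : ℝ) - 1))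
  have hh : AntitoneOn h (Ioi 0) := fun a ha b hb hab => by
    have h1 : ENNReal.ofReal (φ a) ≤ ENNReal.ofReal (φ b) := ENNReal.ofReal_le_ofReal
      (hφ_mono.monotoneOn (mem_Ici.2 (mem_Ioi.1 ha).le) (mem_Ici.2 (mem_Ioi.1 hb).le) hab)
    simp only [h, neg_div, ENNReal.rpow_neg]
    exact ENNReal.inv_le_inv.2 (ENNReal.rpow_le_rpow h1 (by positivity))
  have hint : ∫⁻ s in Ioi 1, (ENNReal.ofReal s * h s) ^ p ≠ ∞ := by
    refine ne_of_eq_of_ne ?_ hφ_int.lintegral_lt_top.ne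
    refine setLIntegral_congr_fun measurableSet_Ioi fun s hs => ?_
    have hs0 : 0 < s := one_pos.trans hs
    dsimp only [h]
    rw [ENNReal.mul_rpow_of_nonneg _ _ hp.le, ← ENNReal.rpow_mul,
      ENNReal.ofReal_mul (by positivity), ENNReal.ofReal_rpow_of_pos hs0,
      ENNReal.ofReal_rpow_of_pos (hφ_pos s hs0)]
    congr 3
    rw [hp_def]
    field_simp
  -- the shift by `3` keeps the sums inside the range `s ≥ 1` after two comparisons with integrals
  let T : ℕ → ℝ≥0∞ := fun i => ∑' j : ℕ, h (i + 3 + j)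
  have hTsum : ∑' i, T i ^ p ≠ ∞ := tsum_rpow_tsum_ne_top hh hp hp1 hint
  have hTt : ∀ i, T i ≠ ∞ := fun i hi => by
    have := ENNReal.ne_top_of_tsum_ne_top hTsum i
    simp [hi, hp] at this
  have hT0 : ∀ i, T i ≠ 0 := fun i hi => by
    have h1 := ENNReal.tsum_eq_zero.1 hi 0
    have h2 : h (i + 3 + (0 : ℕ)) ≠ 0 :=
      (ENNReal.rpow_pos (ENNReal.ofReal_pos.2 (hφ_pos _ (by positivity)))
        ENNReal.ofReal_ne_top).ne'
    exact h2 h1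
  -- a product of balls inside the domain, and the integral over it
  obtain ⟨ε, hε, hεΩ⟩ := Metric.nhds_basis_closedBall.mem_iff.1
    ((hΩ.preimage continuous_joinPt).mem_nhds (show (x₀, y₀) ∈ _ from h₀))
  set d := ε / 2
  have hd : 0 < d := half_pos hε
  set Bx := Metric.closedBall x₀ ε
  set By := Metric.closedBall y₀ ε
  have hBΩ : ∀ x ∈ Bx, ∀ y ∈ By, joinPt x y ∈ Ω := fun x hx y hy =>
    @hεΩ (x, y) (by rw [← closedBall_prod_same]; exact ⟨hx, hy⟩)
  let F : EuclideanSpace ℝ (Fin m) → EuclideanSpace ℝ (Fin n) → ℝ≥0∞ := fun x y =>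
    ENNReal.ofReal (φ (Real.posLog ((max (u (joinPt x y)) 0).toReal ^ r)))
  let I : EuclideanSpace ℝ (Fin m) → ℝ≥0∞ := fun x => ∫⁻ y in By, F x y
  have hI : ∫⁻ x in Bx, I x ≠ ∞ := by
    have hc : IsCompact ((fun p : EuclideanSpace ℝ (Fin m) × EuclideanSpace ℝ (Fin n) =>
        joinPt p.1 p.2) '' (Bx ×ˢ By)) :=
      ((isCompact_closedBall _ _).prod (isCompact_closedBall _ _)).image continuous_joinPt
    have h1 := hu_int.integrableOn_compact_subset
      (by rintro _ ⟨p, hp, rfl⟩; exact hBΩ _ hp.1 _ hp.2) hc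
    rw [← measurePreserving_joinPt.integrableOn_comp_preimage measurableEmbedding_joinPt,
      measurableEmbedding_joinPt.injective.preimage_image, Measure.volume_eq_prod, IntegrableOn,
      ← Measure.prod_restrict] at h1
    have h2 := lintegral_prod _ h1.aestronglyMeasurable.aemeasurable.ennreal_ofReal
    exact h2.symm.trans_ne h1.lintegral_lt_top.ne
  have hlevel : ∀ x ∈ Bx, ∀ y ∈ By, ∀ k : ℕ, ENNReal.ofReal (K ^ k) ≤ (u (joinPt x y)).toENNReal →
      ENNReal.ofReal (φ k) ≤ F x y := fun x hx y hy k hk =>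
    ENNReal.ofReal_le_ofReal (le_growth_of_le_toENNReal hφ_mono hr
      ((hu.left y).lt_top x (hBΩ x hx y hy)).ne hk)
  -- the chain estimate in the second variable
  let A : ℕ → ℝ≥0∞ := fun i =>
    ENNReal.ofReal d ^ (n : ℝ) / (chainConst n K * T i ^ ((n : ℝ) - 1))
  have hδ0 : ENNReal.ofReal d ^ (n : ℝ) ≠ 0 :=
    (ENNReal.rpow_pos (ENNReal.ofReal_pos.2 hd) ENNReal.ofReal_ne_top).ne'
  have hδt : ENNReal.ofReal d ^ (n : ℝ) ≠ ∞ :=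
    ENNReal.rpow_ne_top_of_nonneg (by positivity) ENNReal.ofReal_ne_top
  have hC0 := chainConst_ne_zero n hK
  have hCt := chainConst_ne_top n K
  have hTp0 : ∀ i, T i ^ ((n : ℝ) - 1) ≠ 0 := fun i =>
    (ENNReal.rpow_pos (pos_iff_ne_zero.2 (hT0 i)) (hTt i)).ne'
  have hTpt : ∀ i, T i ^ ((n : ℝ) - 1) ≠ ∞ := fun i =>
    ENNReal.rpow_ne_top_of_nonneg hn1.le (hTt i)
  have hA0 : ∀ i, A i ≠ 0 := fun i =>
    (ENNReal.div_pos hδ0 (ENNReal.mul_ne_top hCt (hTpt i))).ne'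
  have hAt : ∀ i, A i ≠ ∞ := fun i => ENNReal.div_ne_top hδt (mul_ne_zero hC0 (hTp0 i))
  have hAI : ∀ x ∈ Bx, ∀ y ∈ Metric.closedBall y₀ d, ∀ i : ℕ,
      ENNReal.ofReal (K ^ (i + 4)) ≤ (u (joinPt x y)).toENNReal → A i ≤ I x := by
    intro x hx y hy i hi
    refine div_le_of_le_rpow_mul_rpow hn ?_
    have hyB : Metric.closedBall y d ⊆ By := Metric.closedBall_subset_closedBall' (by
      have := Metric.mem_closedBall.1 hy
      simp only [d] at this ⊢
      linarith)
    refine ((hu.right x).radius_le hn hd hK (fun η hη => hBΩ x hx η (hyB hη)) (J := i + 3) hi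
      (W := F x) (A := fun j => ENNReal.ofReal (φ ((i + 3 + j : ℕ) : ℝ))) ?_ ?_ ?_).trans ?_
    · exact fun j => (ENNReal.ofReal_pos.2 (hφ_pos _ (by positivity))).ne'
    · exact fun j => ENNReal.ofReal_ne_top
    · exact fun η hη j hj => hlevel x hx η (hyB hη) _ hj
    · refine mul_le_mul' (ENNReal.rpow_le_rpow (mul_le_mul_right (lintegral_mono_set hyB) _)
        (by positivity)) (le_of_eq ?_)
      simp [T, h]
  -- the chain estimate in the first variable, at a level so high that its tail sum is too small
  have hApow : ∀ i, A i ^ (-1 / ((m : ℝ) - 1)) =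
      (ENNReal.ofReal d ^ (n : ℝ) / chainConst n K) ^ (-1 / ((m : ℝ) - 1)) * T i ^ p := by
    intro i
    simp only [A]
    rw [ENNReal.div_eq_inv_mul, ENNReal.mul_inv (Or.inl hC0) (Or.inl hCt), mul_right_comm,
      ← ENNReal.div_eq_inv_mul,
      ENNReal.mul_rpow_of_ne_top (ENNReal.div_ne_top hδt hC0) (ENNReal.inv_ne_top.2 (hTp0 i)),
      ENNReal.inv_rpow, ← ENNReal.rpow_mul, ← ENNReal.rpow_neg]
    congr 2
    rw [hp_def]
    ring
  set c₁ := (ENNReal.ofReal d ^ (n : ℝ) / chainConst n K) ^ (-1 / ((m : ℝ) - 1))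
  have hc₁ : c₁ ≠ ∞ := by
    simp only [c₁, neg_div, ENNReal.rpow_neg]
    exact ENNReal.inv_ne_top.2 (ENNReal.rpow_pos (ENNReal.div_pos hδ0 hCt)
      (ENNReal.div_ne_top hδt hC0)).ne'
  set c₂ := (chainConst m K * ∫⁻ x in Bx, I x) ^ (1 / (m : ℝ))
  have hc₂ : c₂ ≠ ∞ := ENNReal.rpow_ne_top_of_nonneg (by positivity)
    (ENNReal.mul_ne_top (chainConst_ne_top m K) hI)
  have hq : 0 < ((m : ℝ) - 1) / m := div_pos hm1 (by positivity)
  have hlim : Filter.Tendsto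
      (fun i => c₂ * (c₁ * ∑' k, T (k + i) ^ p) ^ (((m : ℝ) - 1) / m)) Filter.atTop (nhds 0) := by
    have h1 := ENNReal.Tendsto.const_mul (ENNReal.tendsto_sum_nat_add _ hTsum) (Or.inr hc₁)
    have h2 := (ENNReal.continuous_rpow_const (y := ((m : ℝ) - 1) / m)).tendsto _ |>.comp h1
    have h3 := ENNReal.Tendsto.const_mul h2 (Or.inr hc₂)
    simpa [hq] using h3
  obtain ⟨J, hJ⟩ := (hlim.eventually (gt_mem_nhds (ENNReal.ofReal_pos.2 hd))).exists
  refine ⟨K ^ (J + 5), by positivity, ?_⟩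
  filter_upwards [Metric.closedBall_mem_nhds (x₀, y₀) hd] with z hz
  rw [← closedBall_prod_same] at hz
  by_contra! hcon
  refine absurd hJ (not_lt.2 ?_)
  have hxB : Metric.closedBall z.1 d ⊆ Bx := Metric.closedBall_subset_closedBall' (by
    have := Metric.mem_closedBall.1 hz.1
    simp only [d] at this ⊢
    linarith)
  have hyB : z.2 ∈ By := Metric.closedBall_subset_closedBall (by simp only [d]; linarith) hz.2
  refine ((hu.left z.2).radius_le hm hd hK (fun ξ hξ => hBΩ ξ (hxB hξ) z.2 hyB) (J := J + 4)
    (EReal.toENNReal_le_toENNReal hcon.le) (W := I) (A := fun j => A (j + J)) (fun j => hA0 _)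
    (fun j => hAt _) ?_).trans ?_
  · intro ξ hξ j hj
    refine hAI ξ (hxB hξ) z.2 hz.2 (j + J) ?_
    rwa [show j + J + 4 = J + 4 + j by ring]
  · refine mul_le_mul' (ENNReal.rpow_le_rpow (mul_le_mul_right (lintegral_mono_set hxB) _)
      (by positivity)) (le_of_eq ?_)
    simp_rw [hApow, ENNReal.tsum_mul_left]

/-! ### Subharmonicity -/

theorem corollary4p7 (m n : ℕ) (hn : 2 ≤ n) (hmn : n ≤ m)
    (Ω : Set (EuclideanSpace ℝ (Fin (m + n)))) (hΩ_open : IsOpen Ω) (hΩ_conn : IsConnected Ω)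
    (u : EuclideanSpace ℝ (Fin (m + n)) → EReal)
    (hu : IsSeparatelySubharmonicOn u Ω)
    (φ : ℝ → ℝ) (hφ_mono : StrictMonoOn φ (Ici 0)) (hφ_surj : φ '' Ici 0 = Ici 0)
    (hφ_int : IntegrableOn
      (fun s : ℝ => s ^ (((n : ℝ) - 1) / ((m : ℝ) - 1)) * φ s ^ (-1 / ((m : ℝ) - 1)))
      (Ioi 1) volume)
    (r : ℝ) (hr : 0 < r)
    (hu_int : LocallyIntegrableOn
      (fun z => φ (Real.posLog ((max (u z) 0).toReal ^ r))) Ω volume) :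
    IsSubharmonicOn u Ω := by
  have husc : UpperSemicontinuousOn u Ω := by
    intro z hz
    obtain ⟨x, y, rfl⟩ := exists_joinPt_eq z
    obtain ⟨M, hM, hbdd⟩ :=
      hu.exists_eventually_le hn hmn hΩ_open hφ_mono hφ_surj hφ_int hr hu_int hz
    have h := hu.upperSemicontinuousAt hΩ_open hz hM hbdd
    refine UpperSemicontinuousAt.upperSemicontinuousWithinAt _ fun c hc => ?_
    -- transport along the homeomorphism between the product and `ℝ^{m+n}`
    have hinv : Filter.Tendsto (EuclideanSpace.finAddEquivProd (𝕜 := ℝ) (n := m) (m := n))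
        (nhds (joinPt x y)) (nhds (x, y)) := by
      have h1 := (EuclideanSpace.finAddEquivProd (𝕜 := ℝ) (n := m) (m := n)).continuous.tendsto
        (joinPt x y)
      have h2 : joinPt x y = EuclideanSpace.finAddEquivProd.symm (x, y) :=
        joinPt_eq_finAddEquivProd_symm (x, y)
      rw [h2, ContinuousLinearEquiv.apply_symm_apply] at h1
      rwa [h2]
    filter_upwards [hinv.eventually (h c hc)] with z hz
    rwa [joinPt_eq_finAddEquivProd_symm, ContinuousLinearEquiv.symm_apply_apply] at hz
  refine ⟨fun z hz => ?_, husc, fun z ρ hρ hz => hu.le_ballMean husc hρ hz⟩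
  obtain ⟨x, y, rfl⟩ := exists_joinPt_eq z
  exact (hu.left y).lt_top x hz
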